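/- Let $\mathcal A$ be a unital $C^*$-algebra with center $Z(\mathcal A)$, and let $H_{\mathcal A}$ be the standard right Hilbert $\mathcal A$-module of sequences $x=(x_i)_{i\in\mathbb N}$ in $\mathcal A$ for which $\sum_i x_i^*x_i$ converges in norm, with inner product $\langle x,y\rangle=\sum_i x_i^*y_i$. For a Hilbert $\mathcal A$-module $E$, a bounded $\mathcal A$-linear operator $T:E\to E$ is called $\mathcal A$-Fredholm if it is adjointable and there are closed submodules with $E=M_1\,\tilde\oplus\,N_1=M_2\,\tilde\oplus\,N_2$ (direct sums, not necessarily orthogonal), such that $N_1,N_2$ are (algebraically) finitely generated, $T$ restricts to an isomorphism of $M_1$ onto $M_2$, and $T(N_1)\subseteq N_2$. Write $\mathcal M\Phi(E)$ for the set of these operators. For $\alpha\in Z(\mathcal A)$ let $\alpha I$ be the operator $x\mapsto x\alpha$, and put $$\sigma_e^{\mathcal A}(T)=\{\alpha\in Z(\mathcal A)\mid T-\alpha I\notin\mathcal M\Phi(E)\}.$$ Let $F$ and $P$ be bounded adjointable $\mathcal A$-linear operators on $H_{\mathcal A}$. Suppose that $P$ is a (possibly skew) projection, that is, $P^2=P$,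 and that its kernel $N(P)$ is finitely generated. Let $R(P)$ be the range of $P$, a Hilbert $\mathcal A$-module with the inner product of $H_{\mathcal A}$, and let $PF|_{R(P)}:R(P)\to R(P)$ be the compression of $F$. Then $$\sigma_e^{\mathcal A}(F)=\sigma_e^{\mathcal A}\bigl(PF|_{R(P)}\bigr).$$ -/

import Mathlib

open scoped InnerProductSpace

/-! Right Hilbert modules over a C⋆-algebra `A` are treated as Mathlib's `CStarModule`s over the
opposite algebra `Aᵐᵒᵖ`: the right action is `MulOpposite.op a • x = x a`, and the inner product is
`⟪x, y⟫ = MulOpposite.op ⟨x, y⟩`, where `⟨x, y⟩ : A` is linear in `y`, that is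
`⟨x, y a⟩ = ⟨x, y⟩ a`. -/

namespace HilbertModule

section Summability

variable {A : Type*} [CStarAlgebra A]

theorem summable_of_nonneg_of_le [PartialOrder A] [StarOrderedRing A] {f g : ℕ → A}
    (hf : ∀ i, 0 ≤ f i) (hfg : ∀ i, f i ≤ g i) (hg : Summable g) : Summable f := by
  rw [summable_iff_vanishing_norm] at hg ⊢
  intro ε hε
  obtain ⟨s, hs⟩ := hg ε hε
  refine ⟨s, fun t ht => lt_of_le_of_lt ?_ (hs t ht)⟩
  exact CStarAlgebra.norm_le_norm_of_nonneg_of_le (Finset.sum_nonneg fun i _ => hf i)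
    (Finset.sum_le_sum fun i _ => hfg i)

theorem summable_add {x y : ℕ → A} (hx : Summable fun i => star (x i) * x i)
    (hy : Summable fun i => star (y i) * y i) :
    Summable fun i => star (x i + y i) * (x i + y i) := by
  let _ : PartialOrder A := CStarAlgebra.spectralOrder A
  have _ : StarOrderedRing A := CStarAlgebra.spectralOrderedRing A
  refine summable_of_nonneg_of_le (fun i => star_mul_self_nonneg _) (fun i => ?_)
    ((hx.add hy).add (hx.add hy))
  have h : (0 : A) ≤ star (x i - y i) * (x i - y i) := star_mul_self_nonneg _
  rw [← sub_nonneg]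
  convert h using 1
  simp only [star_add, star_sub]
  noncomm_ring

theorem summable_mul_right {x : ℕ → A} (hx : Summable fun i => star (x i) * x i) (a : A) :
    Summable fun i => star (x i * a) * (x i * a) := by
  simpa [mul_assoc] using (hx.mul_left (star a)).mul_right a

theorem summable_inner {x y : ℕ → A} (hx : Summable fun i => star (x i) * x i)
    (hy : Summable fun i => star (y i) * y i) : Summable fun i => star (x i) * y i := by
  have h1 := ((summable_add hx hy).sub hx).sub hy
  have h2 := ((summable_add hx (summable_mul_right hy (algebraMap ℂ A Complex.I))).sub hx).sub hy
  have h3 := (h1.sub (h2.const_smul Complex.I)).const_smul (1 / 2 : ℂ)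
  refine h3.congr fun i => ?_
  have e1 : star (x i + y i) * (x i + y i) - star (x i) * x i - star (y i) * y i
      = star (x i) * y i + star (y i) * x i := by
    rw [star_add]; noncomm_ring
  have e2 : star (x i + y i * algebraMap ℂ A Complex.I) * (x i + y i * algebraMap ℂ A Complex.I)
      - star (x i) * x i - star (y i) * y i
      = Complex.I • (star (x i) * y i) - Complex.I • (star (y i) * x i) := by
    rw [← Algebra.commutes, ← Algebra.smul_def, star_add, star_smul]
    have hI : Complex.I • Complex.I • (star (y i) * y i) = -(star (y i) * y i) := by
      rw [smul_smul, Complex.I_mul_I, neg_one_smul]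
    simp only [add_mul, mul_add, smul_mul_assoc, mul_smul_comm, Complex.star_def, Complex.conj_I,
      neg_smul, smul_neg, neg_mul, smul_add, hI]
    abel
  have e3 : Complex.I • (Complex.I • (star (x i) * y i) - Complex.I • (star (y i) * x i))
      = star (y i) * x i - star (x i) * y i := by
    rw [smul_sub, smul_smul, smul_smul, Complex.I_mul_I]
    module
  rw [e1, e2, e3]
  module

end Summability

section StandardModule

/-- The sequences `x` in `A` for which `∑ xᵢ⋆ xᵢ` converges in norm. -/
def standardSubmodule (A : Type*) [CStarAlgebra A] : Submodule Aᵐᵒᵖ (ℕ → A) where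
  carrier := {x | Summable fun i => star (x i) * x i}
  add_mem' hx hy := summable_add hx hy
  zero_mem' := by simp
  smul_mem' a _ hx := summable_mul_right hx a.unop

/-- The standard (countably generated) right Hilbert module `H_A = ℓ²(A)`. -/
def StandardModule (A : Type*) [CStarAlgebra A] : Type _ := ↥(standardSubmodule A)

variable {A : Type*} [CStarAlgebra A]

noncomputable instance : AddCommGroup (StandardModule A) :=
  inferInstanceAs (AddCommGroup ↥(standardSubmodule A))

noncomputable instance : Module Aᵐᵒᵖ (StandardModule A) :=
  inferInstanceAs (Module Aᵐᵒᵖ ↥(standardSubmodule A))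

noncomputable instance : Module ℂ (StandardModule A) :=
  inferInstanceAs (Module ℂ ↥(standardSubmodule A))

instance : IsScalarTower ℂ Aᵐᵒᵖ (StandardModule A) :=
  inferInstanceAs (IsScalarTower ℂ Aᵐᵒᵖ ↥(standardSubmodule A))

instance : CoeFun (StandardModule A) (fun _ => ℕ → A) := ⟨Subtype.val⟩

theorem StandardModule.summable (x y : StandardModule A) : Summable fun i => star (x i) * y i :=
  summable_inner x.2 y.2

/-- `‖x‖ = ‖∑ xᵢ⋆ xᵢ‖^{1/2}`. -/
noncomputable instance : Norm (StandardModule A) where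
  norm x := √‖∑' i, star (x i) * x i‖

/-- The inner product is `⟨x, y⟩ = ∑ xᵢ⋆ yᵢ`. -/
noncomputable instance [PartialOrder A] [StarOrderedRing A] :
    CStarModule Aᵐᵒᵖ (StandardModule A) where
  inner x y := MulOpposite.op (∑' i, star (x i) * y i)
  inner_add_right {x y z} := by
    rw [← MulOpposite.op_add, ← (x.summable y).tsum_add (x.summable z)]
    congr 2
    funext i
    exact mul_add _ _ _
  inner_self_nonneg {x} := MulOpposite.op_nonneg.2 (tsum_nonneg fun i => star_mul_self_nonneg _)
  inner_self {x} := by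
    rw [MulOpposite.op_eq_zero_iff]
    constructor
    · intro h
      have h0 : HasSum (fun i => star (x i) * x i) 0 := h ▸ (x.summable x).hasSum
      refine Subtype.ext (funext fun i => ?_)
      have hi := le_hasSum h0 i fun j _ => star_mul_self_nonneg _
      exact CStarRing.star_mul_self_eq_zero_iff _ |>.1 (le_antisymm hi (star_mul_self_nonneg _))
    · rintro rfl
      exact (tsum_congr fun i => mul_zero _).trans tsum_zero
  inner_op_smul_right {a x y} := by
    apply MulOpposite.unop_injective
    change ∑' i, star (x i) * (y i * a.unop) = (∑' i, star (x i) * y i) * a.unop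
    rw [← (x.summable y).tsum_mul_right]
    simp only [mul_assoc]
  inner_smul_right_complex {z x y} := by
    apply MulOpposite.unop_injective
    change ∑' i, star (x i) * (z • y i) = z • ∑' i, star (x i) * y i
    rw [← (x.summable y).tsum_const_smul]
    simp only [mul_smul_comm]
  star_inner x y := by
    apply MulOpposite.unop_injective
    change star (∑' i, star (x i) * y i) = ∑' i, star (y i) * x i
    rw [tsum_star]
    simp
  norm_eq_sqrt_norm_inner_self _ := rfl

theorem StandardModule.normedSpaceCore : NormedSpace.Core ℂ (StandardModule A) := by
  let _ : PartialOrder A := CStarAlgebra.spectralOrder A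
  have _ : StarOrderedRing A := CStarAlgebra.spectralOrderedRing A
  exact CStarModule.normedSpaceCore Aᵐᵒᵖ

noncomputable instance : NormedAddCommGroup (StandardModule A) :=
  NormedAddCommGroup.ofCore StandardModule.normedSpaceCore

noncomputable instance : NormedSpace ℂ (StandardModule A) :=
  NormedSpace.ofCore StandardModule.normedSpaceCore

end StandardModule

section Operators

variable {A : Type*} [CStarAlgebra A] [PartialOrder A]
variable {E : Type*} [NormedAddCommGroup E] [NormedSpace ℂ E] [Module Aᵐᵒᵖ E]

/-- A submodule of a Hilbert module, with the restricted inner product. -/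
noncomputable instance [CStarModule Aᵐᵒᵖ E] [IsScalarTower ℂ Aᵐᵒᵖ E] (S : Submodule Aᵐᵒᵖ E) :
    CStarModule Aᵐᵒᵖ S where
  inner x y := inner Aᵐᵒᵖ (x : E) (y : E)
  inner_add_right := CStarModule.inner_add_right
  inner_self_nonneg := CStarModule.inner_self_nonneg
  inner_self := CStarModule.inner_self.trans Submodule.coe_eq_zero
  inner_op_smul_right := CStarModule.inner_op_smul_right
  inner_smul_right_complex := CStarModule.inner_smul_right_complex
  star_inner _ _ := CStarModule.star_inner _ _
  norm_eq_sqrt_norm_inner_self x := CStarModule.norm_eq_sqrt_norm_inner_self (A := Aᵐᵒᵖ) (x : E)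

variable [CStarModule Aᵐᵒᵖ E]

theorem norm_op_smul_le (b : Aᵐᵒᵖ) (x : E) : ‖b • x‖ ≤ ‖b‖ * ‖x‖ := by
  refine (sq_le_sq₀ (norm_nonneg _) (by positivity)).1 ?_
  rw [mul_pow, CStarModule.norm_sq_eq Aᵐᵒᵖ, CStarModule.norm_sq_eq Aᵐᵒᵖ (x := x),
    CStarModule.inner_op_smul_right, CStarModule.inner_op_smul_left]
  calc ‖b * (inner Aᵐᵒᵖ x x * star b)‖ ≤ ‖b‖ * (‖inner Aᵐᵒᵖ x x‖ * ‖star b‖) :=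
        (norm_mul_le _ _).trans (by gcongr; exact norm_mul_le _ _)
    _ = ‖b‖ ^ 2 * ‖inner Aᵐᵒᵖ x x‖ := by rw [norm_star]; ring

/-- A bounded `A`-linear operator is adjointable if it has a bounded `A`-linear adjoint. -/
def IsAdjointable (F : E →L[Aᵐᵒᵖ] E) : Prop :=
  ∃ G : E →L[Aᵐᵒᵖ] E, ∀ x y : E, inner Aᵐᵒᵖ (F x) y = inner Aᵐᵒᵖ x (G y)

/-- `F` is an `A`-Fredholm operator on `E`: it is adjointable and there are decompositions
`E = M₁ ∔ N₁` and `E = M₂ ∔ N₂` (not necessarily orthogonal) into closed submodules, with `N₁` and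
`N₂` finitely generated, for which `F` has a diagonal matrix whose entry `M₁ → M₂` is an
isomorphism. -/
def IsAFredholm (F : E →L[Aᵐᵒᵖ] E) : Prop :=
  IsAdjointable F ∧
  ∃ M₁ N₁ M₂ N₂ : Submodule Aᵐᵒᵖ E,
    IsClosed (M₁ : Set E) ∧ IsClosed (N₁ : Set E) ∧
    IsClosed (M₂ : Set E) ∧ IsClosed (N₂ : Set E) ∧
    IsCompl M₁ N₁ ∧ IsCompl M₂ N₂ ∧
    N₁.FG ∧ N₂.FG ∧
    (∃ e : M₁ ≃L[Aᵐᵒᵖ] M₂, ∀ x : M₁, (e x : E) = F x) ∧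
    ∀ x ∈ N₁, F x ∈ N₂

/-- The operator `α I : x ↦ x α` for `α` in the center of `A`. -/
def centralOp (E : Type*) [NormedAddCommGroup E] [NormedSpace ℂ E] [Module Aᵐᵒᵖ E]
    [CStarModule Aᵐᵒᵖ E] (α : Subalgebra.center ℂ A) : E →L[Aᵐᵒᵖ] E where
  toFun x := MulOpposite.op (α : A) • x
  map_add' := smul_add _
  map_smul' b x := by
    have h : MulOpposite.op (α : A) * b = b * MulOpposite.op (α : A) :=
      MulOpposite.unop_injective (Subalgebra.mem_center_iff.1 α.2 b.unop)
    simp only [RingHom.id_apply, smul_smul, h]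
  cont := AddMonoidHomClass.continuous_of_bound
    (DistribSMul.toAddMonoidHom E (MulOpposite.op (α : A))) _ (norm_op_smul_le _)

/-- The generalized essential (`A`-Fredholm) spectrum of `F` in the center `Z(A)`. -/
def essentialSpectrum (F : E →L[Aᵐᵒᵖ] E) : Set (Subalgebra.center ℂ A) :=
  {α | ¬ IsAFredholm (F - centralOp E α)}

end Operators

/-- The compression `P F|_{R(P)}`, as an operator on the range `R(P)` of `P`. -/
def compression {A : Type*} [CStarAlgebra A] {E : Type*} [NormedAddCommGroup E]
    [Module Aᵐᵒᵖ E] (P F : E →L[Aᵐᵒᵖ] E) : P.range →L[Aᵐᵒᵖ] P.range :=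
  (P ∘L F ∘L P.range.subtypeL).codRestrict P.range fun _ => ⟨_, rfl⟩

end HilbertModule

/-!
Write `T = F - α I`. The compression of `T` is the compression of `F` minus `α I`. So the theorem
says that `T` is `A`-Fredholm on `H_A` if and only if its compression is `A`-Fredholm on `R(P)`.

The idea is Atkinson's characterization: Fredholm means invertible modulo a class of small
operators. The class used here consists of the operators of *finite type* (`IsFiniteType`), whose
values are combinations of finitely many vectors with controlled coefficients. By the open mapping
theorem, every bounded operator into a closed finitely generated submodule is of finite type
(`isFiniteType_of_mem`); no projectivity of that submodule is needed. Hence a Fredholm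
decomposition yields a parametrix modulo operators of finite type
(`HasFredholmDecomposition.exists_parametrix`).

Conversely, suppose that every finite set of vectors is almost fixed by some idempotent `g` with
finitely generated range (`HasFiniteApproximation`). Given a parametrix `S` of `T`, choose `g` with
`(1 - g) (1 - S T)` of norm below one. Then `T` has a left inverse `L` on `N(g)`, so that
`L T L = L`, and the idempotents `L T` and `T L` provide the two decompositions; their kernels are
finitely generated because `1 - T S` has values in a finitely generated submodule
(`hasFredholmDecomposition_of_parametrix`).

The truncations to finitely many coordinates show that `H_A` has finite approximation. A
perturbation of `P` transfers this to `R(P)` (`HasFiniteApproximation.range`), since `N(P)` is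
finitely generated and so `1 - P` is of finite type. Parametrices compress to `R(P)` and extend from
`R(P)` up to terms containing `1 - P` (`hasFredholmDecomposition_compression_iff`).

It remains to see that the compression is adjointable although `P` may be skew. This amounts to
representing the elements of `H_A`, as functionals on `R(P)`, by elements of `R(P)`, which rests on
the invertibility of `1 + V` for skew-adjoint `V` (`isUnit_one_add_of_skew`,
`isAdjointable_compression`).
-/

namespace HilbertModule

/-! ### Fredholm decompositions and parametrices in Banach modules -/

section BanachModules

variable {R : Type*} [NormedRing R]
variable {E : Type*} [NormedAddCommGroup E] [Module R E]
variable {E' : Type*} [NormedAddCommGroup E'] [Module R E']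

/-- `Φ` is of finite type if its values are combinations of finitely many fixed vectors, with
coefficients bounded by a multiple of the norm of the argument. The coefficients need not depend
linearly on the argument. -/
def IsFiniteType (Φ : E →L[R] E') : Prop :=
  ∃ (k : ℕ) (v : Fin k → E') (C : ℝ), 0 ≤ C ∧
    ∀ x, ∃ c : Fin k → R, Φ x = ∑ i, c i • v i ∧ ∀ i, ‖c i‖ ≤ C * ‖x‖

theorem IsFiniteType.comp_left {E'' : Type*} [NormedAddCommGroup E''] [Module R E'']
    {Φ : E →L[R] E'} (h : IsFiniteType Φ) (T : E' →L[R] E'') : IsFiniteType (T ∘L Φ) := by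
  obtain ⟨k, v, C, hC, h⟩ := h
  refine ⟨k, fun i => T (v i), C, hC, fun x => ?_⟩
  obtain ⟨c, hx, hc⟩ := h x
  exact ⟨c, by simp [hx], hc⟩

theorem IsFiniteType.add {Φ Ψ : E →L[R] E'} (h : IsFiniteType Φ) (h' : IsFiniteType Ψ) :
    IsFiniteType (Φ + Ψ) := by
  obtain ⟨k, v, C, hC, h⟩ := h
  obtain ⟨l, w, D, hD, h'⟩ := h'
  refine ⟨k + l, Fin.append v w, C + D, by positivity, fun x => ?_⟩
  obtain ⟨c, hx, hc⟩ := h x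
  obtain ⟨d, hx', hd⟩ := h' x
  refine ⟨Fin.append c d, ?_, fun i => ?_⟩
  · simp [Fin.sum_univ_add, hx, hx']
  · rw [add_mul]
    have h1 := mul_nonneg hC (norm_nonneg x)
    have h2 := mul_nonneg hD (norm_nonneg x)
    refine Fin.addCases (fun j => ?_) (fun j => ?_) i
    · rw [Fin.append_left]; linarith [hc j]
    · rw [Fin.append_right]; linarith [hd j]

theorem IsFiniteType.exists_fg {Φ : E →L[R] E'} (h : IsFiniteType Φ) :
    ∃ N : Submodule R E', N.FG ∧ ∀ x, Φ x ∈ N := by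
  obtain ⟨k, v, C, hC, h⟩ := h
  refine ⟨Submodule.span R (Set.range v), Submodule.fg_span (Set.finite_range v), fun x => ?_⟩
  obtain ⟨c, hx, -⟩ := h x
  rw [hx]
  exact Submodule.sum_smul_mem _ _ fun i _ => Submodule.subset_span ⟨i, rfl⟩

/-- Every finite family of vectors is almost fixed by a continuous idempotent with finitely
generated range. -/
def HasFiniteApproximation (R E : Type*) [NormedRing R] [NormedAddCommGroup E] [Module R E] :
    Prop :=
  ∀ (s : Set E) (ε : ℝ), s.Finite → 0 < ε →
    ∃ g : E →L[R] E, (∀ x, g (g x) = g x) ∧ g.range.FG ∧ ∀ v ∈ s, ‖v - g v‖ ≤ ε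

/-- Approximating the finitely many vectors that occur in the values of `Φ` approximates `Φ` in
norm. This is where the bound on the coefficients is needed; the idempotents need not be uniformly
bounded. -/
theorem HasFiniteApproximation.exists_norm_sub_le [IsBoundedSMul R E']
    (h : HasFiniteApproximation R E')
    {Φ : E →L[R] E'} (hΦ : IsFiniteType Φ) {s : Set E'} (hs : s.Finite) {ε : ℝ} (hε : 0 < ε) :
    ∃ g : E' →L[R] E', (∀ x, g (g x) = g x) ∧ g.range.FG ∧ (∀ v ∈ s, ‖v - g v‖ ≤ ε) ∧
      ∀ x, ‖Φ x - g (Φ x)‖ ≤ ε * ‖x‖ := by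
  obtain ⟨k, v, C, hC, hv⟩ := hΦ
  have hpos : 0 < C * k + 1 := by positivity
  obtain ⟨g, hg, hfg, hgv⟩ := h (s ∪ Set.range v) (min ε (ε / (C * k + 1)))
    (hs.union (Set.finite_range v)) (by positivity)
  refine ⟨g, hg, hfg, fun w hw => (hgv w (.inl hw)).trans (min_le_left _ _), fun x => ?_⟩
  obtain ⟨c, hx, hc⟩ := hv x
  have e : Φ x - g (Φ x) = ∑ i, c i • (v i - g (v i)) := by
    simp [hx, smul_sub, Finset.sum_sub_distrib]
  calc ‖Φ x - g (Φ x)‖ ≤ ∑ i : Fin k, (C * ‖x‖) * (ε / (C * k + 1)) := by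
        rw [e]
        refine norm_sum_le_of_le _ fun i _ => (norm_smul_le _ _).trans ?_
        exact mul_le_mul (hc i) ((hgv _ (.inr ⟨i, rfl⟩)).trans (min_le_right _ _))
          (norm_nonneg _) (by positivity)
    _ = ε * ‖x‖ * (C * k / (C * k + 1)) := by
        simp only [Finset.sum_const, Finset.card_univ, Fintype.card_fin, nsmul_eq_mul]; ring
    _ ≤ ε * ‖x‖ * 1 := by
        gcongr
        rw [div_le_one hpos]
        linarith
    _ = ε * ‖x‖ := mul_one _

/-- The decomposition required of an `A`-Fredholm operator, over an arbitrary ring of scalars and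
without the condition of adjointability. -/
def HasFredholmDecomposition (F : E →L[R] E) : Prop :=
  ∃ M₁ N₁ M₂ N₂ : Submodule R E,
    IsClosed (M₁ : Set E) ∧ IsClosed (N₁ : Set E) ∧
    IsClosed (M₂ : Set E) ∧ IsClosed (N₂ : Set E) ∧
    IsCompl M₁ N₁ ∧ IsCompl M₂ N₂ ∧
    N₁.FG ∧ N₂.FG ∧
    (∃ e : M₁ ≃L[R] M₂, ∀ x : M₁, (e x : E) = F x) ∧
    ∀ x ∈ N₁, F x ∈ N₂

/-- A generalized inverse `L` of `F`, in the sense that `L F L = L`, yields the decompositions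
`E = R(L F) ∔ N(L F)` and `E = R(F L) ∔ N(F L)`, which diagonalize `F`. -/
theorem hasFredholmDecomposition_of_generalized_inverse {F L : E →L[R] E}
    (h : ∀ x, L (F (L x)) = L x) (h₁ : (L ∘L F).ker.FG) (h₂ : (F ∘L L).ker.FG) :
    HasFredholmDecomposition F := by
  have i₁ : IsIdempotentElem (L ∘L F) := by ext x; simp [h]
  have i₂ : IsIdempotentElem (F ∘L L) := by ext x; simp [h]
  have t₁ := ContinuousLinearMap.IsIdempotentElem.isTopCompl i₁
  have t₂ := ContinuousLinearMap.IsIdempotentElem.isTopCompl i₂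
  have hFm : ∀ x : (L ∘L F).range, F x ∈ (F ∘L L).range := by
    rintro ⟨_, y, rfl⟩
    exact ⟨F y, rfl⟩
  have hLm : ∀ x : (F ∘L L).range, L x ∈ (L ∘L F).range := by
    rintro ⟨_, y, rfl⟩
    exact ⟨L y, rfl⟩
  refine ⟨(L ∘L F).range, (L ∘L F).ker, (F ∘L L).range, (F ∘L L).ker, t₁.isClosed, t₁.isClosed',
    t₂.isClosed, t₂.isClosed', t₁.isCompl, t₂.isCompl, h₁, h₂,
    ⟨ContinuousLinearEquiv.equivOfInverse
      ((F ∘L Submodule.subtypeL _).codRestrict _ hFm)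
      ((L ∘L Submodule.subtypeL _).codRestrict _ hLm) ?_ ?_, ?_⟩, ?_⟩
  · rintro ⟨_, y, rfl⟩
    exact Subtype.ext (h _)
  · rintro ⟨_, y, rfl⟩
    exact Subtype.ext (congrArg F (h _))
  · intro x; rfl
  · intro x hx
    have hx : L (F x) = 0 := hx
    simp [hx]

variable [NormedAlgebra ℂ R] [NormedSpace ℂ E] [IsScalarTower ℂ R E]
variable [NormedSpace ℂ E'] [IsScalarTower ℂ R E']

theorem exists_bound (T : E →L[R] E') : ∃ C : ℝ, 0 ≤ C ∧ ∀ x, ‖T x‖ ≤ C * ‖x‖ :=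
  ⟨‖T.restrictScalars ℂ‖, norm_nonneg _, (T.restrictScalars ℂ).le_opNorm⟩

/-- Closed complementary submodules of a Banach module are topological complements. The norm is
only compatible with complex scalars, so the closed graph theorem is applied over `ℂ`. -/
theorem isTopCompl_of_isClosed [CompleteSpace E] {M N : Submodule R E} (h : IsCompl M N)
    (hM : IsClosed (M : Set E)) (hN : IsClosed (N : Set E)) : M.IsTopCompl N := by
  have h' : IsCompl (M.restrictScalars ℂ) (N.restrictScalars ℂ) :=
    (Submodule.isCompl_restrictScalars_iff ℂ).2 h
  have hc := (Submodule.IsCompl.isTopCompl_of_isClosed h' hM hN).continuous_projection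
  refine ⟨h, hc.congr fun x => ?_⟩
  obtain ⟨m, hm, n, hn, rfl⟩ := Submodule.mem_sup.1 (h.sup_eq_top ▸ Submodule.mem_top (x := x))
  rw [map_add, map_add, Submodule.projection_apply_of_mem_left h hm,
    Submodule.projection_apply_of_mem_right h hn,
    Submodule.projection_apply_of_mem_left h' hm, Submodule.projection_apply_of_mem_right h' hn]

/-- The inverse of a linear operator over `R` that is invertible over `ℂ` is linear over `R`. -/
theorem exists_inverse_of_isUnit (V : E →L[R] E) (h : IsUnit (V.restrictScalars ℂ)) :
    ∃ W : E →L[R] E, (∀ x, V (W x) = x) ∧ ∀ x, W (V x) = x := by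
  obtain ⟨u, hu⟩ := h
  have hr : ∀ x, V ((↑u⁻¹ : E →L[ℂ] E) x) = x := fun x => by
    have := DFunLike.congr_fun u.mul_inv x
    rwa [hu] at this
  have hl : ∀ x, (↑u⁻¹ : E →L[ℂ] E) (V x) = x := fun x => by
    have := DFunLike.congr_fun u.inv_mul x
    rwa [hu] at this
  refine ⟨{ toFun := (↑u⁻¹ : E →L[ℂ] E)
            map_add' := map_add _
            map_smul' := fun a x => Function.LeftInverse.injective hl ?_
            cont := (↑u⁻¹ : E →L[ℂ] E).continuous }, hr, hl⟩
  rw [RingHom.id_apply, V.map_smul, hr, hr]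

/-- A continuous linear endomorphism that is close to the identity is invertible. -/
theorem exists_inverse_of_norm_sub_le [CompleteSpace E] (V : E →L[R] E) {c : ℝ} (hc : c < 1)
    (hc0 : 0 ≤ c) (hV : ∀ x, ‖x - V x‖ ≤ c * ‖x‖) :
    ∃ W : E →L[R] E, (∀ x, V (W x) = x) ∧ (∀ x, W (V x) = x) ∧
      ∀ x, ‖W x‖ ≤ (1 - c)⁻¹ * ‖x‖ := by
  have hn : ‖1 - V.restrictScalars ℂ‖ < 1 :=
    lt_of_le_of_lt (ContinuousLinearMap.opNorm_le_bound _ hc0 hV) hc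
  have hu := isUnit_one_sub_of_norm_lt_one hn
  rw [sub_sub_cancel] at hu
  obtain ⟨W, hr, hl⟩ := exists_inverse_of_isUnit V hu
  refine ⟨W, hr, hl, fun x => ?_⟩
  rw [inv_mul_eq_div, le_div_iff₀ (by linarith)]
  have h1 := hV (W x)
  rw [hr] at h1
  have h2 := norm_le_norm_add_norm_sub' (W x) x
  linarith

theorem IsFiniteType.comp_right {E'' : Type*} [NormedAddCommGroup E''] [Module R E'']
    {Φ : E →L[R] E''} (h : IsFiniteType Φ)
    (T : E' →L[R] E) : IsFiniteType (Φ ∘L T) := by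
  obtain ⟨k, v, C, hC, h⟩ := h
  obtain ⟨D, hD, hT⟩ := exists_bound T
  refine ⟨k, v, C * D, by positivity, fun x => ?_⟩
  obtain ⟨c, hx, hc⟩ := h (T x)
  refine ⟨c, hx, fun i => (hc i).trans ?_⟩
  rw [mul_assoc]
  exact mul_le_mul_of_nonneg_left (hT x) hC

/-- By the open mapping theorem, preimages under `Rᵏ → N` can be chosen with controlled norm. -/
theorem isFiniteType_of_mem [CompleteSpace R] [CompleteSpace E'] [IsBoundedSMul R E']
    (Φ : E →L[R] E') {N : Submodule R E'} (hN : IsClosed (N : Set E')) (hfg : N.FG)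
    (h : ∀ x, Φ x ∈ N) : IsFiniteType Φ := by
  obtain ⟨k, v, hv⟩ := Submodule.fg_iff_exists_fin_generating_family.1 hfg
  have := hN.completeSpace_coe
  have hmem : ∀ i, v i ∈ N := fun i => hv ▸ Submodule.subset_span ⟨i, rfl⟩
  let f : (Fin k → R) →L[R] N :=
    { toFun := fun c => ∑ i, c i • (⟨v i, hmem i⟩ : N)
      map_add' := fun c d => by
        simp only [Pi.add_apply, add_smul, Finset.sum_add_distrib]
      map_smul' := fun a c => by simp [Finset.smul_sum, mul_smul]
      cont := by fun_prop }
  have hf : Function.Surjective (f.restrictScalars ℂ) := fun y => by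
    obtain ⟨c, hc⟩ := (Submodule.mem_span_range_iff_exists_fun R).1 (hv.ge y.2)
    exact ⟨c, Subtype.ext (by simpa [f] using hc)⟩
  obtain ⟨C, hC, hpre⟩ := (f.restrictScalars ℂ).exists_preimage_norm_le hf
  obtain ⟨D, hD, hΦ⟩ := exists_bound Φ
  refine ⟨k, v, C * D, by positivity, fun x => ?_⟩
  obtain ⟨c, hc, hcn⟩ := hpre ⟨Φ x, h x⟩
  refine ⟨c, ?_, fun i => (norm_le_pi_norm c i).trans (hcn.trans ?_)⟩
  · have := congrArg Subtype.val hc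
    simpa [f] using this.symm
  · rw [mul_assoc]
    exact mul_le_mul_of_nonneg_left (hΦ x) hC.le

/-- The parametrix inverts `F : M₁ → M₂` and vanishes on `N₂`; the defects are the projections
onto `N₁` and `N₂`. -/
theorem HasFredholmDecomposition.exists_parametrix [CompleteSpace R] [CompleteSpace E]
    [IsBoundedSMul R E] {F : E →L[R] E} (h : HasFredholmDecomposition F) :
    ∃ S : E →L[R] E, IsFiniteType (1 - S ∘L F) ∧ IsFiniteType (1 - F ∘L S) := by
  obtain ⟨M₁, N₁, M₂, N₂, hM₁, hN₁, hM₂, hN₂, hc₁, hc₂, hf₁, hf₂, ⟨e, he⟩, hF⟩ := h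
  have ht := isTopCompl_of_isClosed hc₂ hM₂ hN₂
  refine ⟨M₁.subtypeL ∘L (e.symm : M₂ →L[R] M₁) ∘L M₂.projectionOntoL N₂ ht,
    isFiniteType_of_mem _ hN₁ hf₁ fun x => ?_, isFiniteType_of_mem _ hN₂ hf₂ fun x => ?_⟩
  · obtain ⟨m, hm, n, hn, rfl⟩ := Submodule.mem_sup.1 (hc₁.sup_eq_top ▸ Submodule.mem_top (x := x))
    have h1 : M₂.projectionOntoL N₂ ht (F m) = e ⟨m, hm⟩ := by
      rw [← he ⟨m, hm⟩]; exact Submodule.projectionOntoL_apply_left ht _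
    have h2 : M₂.projectionOntoL N₂ ht (F n) = 0 :=
      Submodule.projectionOntoL_apply_right ht ⟨F n, hF n hn⟩
    have e1 : (1 - (M₁.subtypeL ∘L (e.symm : M₂ →L[R] M₁) ∘L M₂.projectionOntoL N₂ ht) ∘L F)
        (m + n) = n := by
      simp [-Submodule.coe_projectionOntoL, h1, h2]
    rwa [e1]
  · obtain ⟨m, hm, n, hn, rfl⟩ := Submodule.mem_sup.1 (hc₂.sup_eq_top ▸ Submodule.mem_top (x := x))
    have h1 : M₂.projectionOntoL N₂ ht m = ⟨m, hm⟩ :=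
      Submodule.projectionOntoL_apply_left ht ⟨m, hm⟩
    have h2 : M₂.projectionOntoL N₂ ht n = 0 := Submodule.projectionOntoL_apply_right ht ⟨n, hn⟩
    have h3 : F (e.symm ⟨m, hm⟩) = m := by rw [← he]; simp
    have e1 : (1 - F ∘L M₁.subtypeL ∘L (e.symm : M₂ →L[R] M₁) ∘L M₂.projectionOntoL N₂ ht)
        (m + n) = n := by
      simp [-Submodule.coe_projectionOntoL, h1, h2, h3]
    rwa [e1]

/-- Invertibility modulo operators of finite type suffices. For an idempotent `g` of finitely
generated range with `(1 - g)(1 - S F)` small, `1 - (1 - g)(1 - S F)` has an inverse `W` and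
`W (1 - g) S` is a generalized inverse of `F` with range `N(g)`. -/
theorem hasFredholmDecomposition_of_parametrix [CompleteSpace E] [IsBoundedSMul R E]
    (hE : HasFiniteApproximation R E) {F S : E →L[R] E} (hl : IsFiniteType (1 - S ∘L F))
    (hr : IsFiniteType (1 - F ∘L S)) : HasFredholmDecomposition F := by
  obtain ⟨g, hg, hgfg, -, hgΦ⟩ := hE.exists_norm_sub_le hl Set.finite_empty one_half_pos
  obtain ⟨N, hN, hrN⟩ := hr.exists_fg
  obtain ⟨V, hV⟩ : ∃ V : E →L[R] E, V = 1 - (1 - g) ∘L (1 - S ∘L F) := ⟨_, rfl⟩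
  obtain ⟨W, hVW, hWV, -⟩ := exists_inverse_of_norm_sub_le V (c := 1 / 2) (by norm_num)
    (by norm_num) (fun x => by
      have e : x - V x = (1 - S ∘L F) x - g ((1 - S ∘L F) x) := by
        simp only [hV, sub_apply, ContinuousLinearMap.comp_apply,
          one_apply_eq_self, map_sub]
        abel
      exact e ▸ hgΦ x)
  have hgV : ∀ x, g (V x) = g x := fun x => by simp [hV, hg]
  have hgW : ∀ x, g (W x) = g x := fun x => by rw [← hgV (W x), hVW]
  -- `g W = g`, so `L` has values in `N(g)`, and it is a left inverse of `F` there
  set L : E →L[R] E := W ∘L (1 - g) ∘L S with hL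
  have hgL : ∀ x, g (L x) = 0 := fun x => by simp [hL, hgW, hg]
  have hLF : ∀ m, g m = 0 → L (F m) = m := fun m hm => by
    conv_rhs => rw [← hWV m]
    simp [hL, hV, hm]
  have hLFL : ∀ x, L (F (L x)) = L x := fun x => hLF _ (hgL x)
  have hker : ∀ y, L y = 0 → S y = g (S y) := fun y hy => by
    have h1 := hVW ((1 - g) (S y))
    have h2 : W ((1 - g) (S y)) = 0 := hy
    rw [h2, map_zero] at h1
    simpa [sub_eq_zero] using h1.symm
  refine hasFredholmDecomposition_of_generalized_inverse hLFL ?_ ?_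
  -- `1 - L F` vanishes on `N(g)`, so its range `N(L F)` is the image of `R(g)`
  · have e : (L ∘L F).ker = g.range.map (1 - L ∘L F : E →L[R] E).toLinearMap := by
      refine le_antisymm (fun x hx => ?_) ?_
      · have hx : L (F x) = 0 := hx
        refine ⟨g x, ⟨x, rfl⟩, ?_⟩
        have := hLF (x - g x) (by simp [hg])
        simp only [map_sub, hx] at this
        simp [sub_eq_iff_eq_add] at this ⊢
        rw [← sub_eq_zero] at this ⊢
        rw [← this]; abel
      · rintro _ ⟨x, -, rfl⟩
        simp [hLFL]
    rw [e]
    exact hgfg.map _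
  -- for `y ∈ N(F L)`, `S y ∈ R(g)`, so `y = F S y + (1 - F S) y` lies in `F (R(g)) + N`
  · have e : (F ∘L L).ker
        = (g.range.map F.toLinearMap ⊔ N).map (1 - F ∘L L : E →L[R] E).toLinearMap := by
      refine le_antisymm (fun y hy => ?_) ?_
      · have hy : F (L y) = 0 := hy
        have hLy : L y = 0 := by rw [← hLFL y, hy, map_zero]
        refine ⟨y, ?_, by simp [hy]⟩
        have hy' : y = F (g (S y)) + (1 - F ∘L S) y := by simp [← hker y hLy]
        rw [hy']
        exact Submodule.add_mem_sup ⟨_, ⟨_, rfl⟩, rfl⟩ (hrN y)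
      · rintro _ ⟨x, -, rfl⟩
        simp [hLFL]
    rw [e]
    exact ((hgfg.map _).sup hN).map _

end BanachModules

/-! ### Finite approximation in the range of an idempotent -/

section RangeApproximation

variable {R : Type*} [NormedRing R] [NormedAlgebra ℂ R]
variable {E : Type*} [NormedAddCommGroup E] [NormedSpace ℂ E] [Module R E] [IsScalarTower ℂ R E]
  [IsBoundedSMul R E] [CompleteSpace E]

/-- Finite approximation passes to the range of an idempotent `P` with `1 - P` of finite type.
If `(1 - p)(1 - P)` is small, then `V = 1 - (1 - p)(1 - P)` is invertible, fixes `R(P)` pointwise and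
maps `N(P)` into `R(p)`. Hence `P V⁻¹` is an idempotent with range `R(P)` whose kernel lies in
`R(p)`, and `P V⁻¹ p` is an idempotent of finitely generated range contained in `R(P)`. -/
theorem HasFiniteApproximation.range (hE : HasFiniteApproximation R E) {P : E →L[R] E}
    (hP : ∀ x, P (P x) = P x) (hQ : IsFiniteType (1 - P)) :
    HasFiniteApproximation R P.range := by
  intro s ε hs hε
  obtain ⟨C, hC, hPC⟩ := exists_bound P
  obtain ⟨p, hp, hpfg, hps, hpQ⟩ := hE.exists_norm_sub_le hQ
    (hs.image Subtype.val) (ε := min (1 / 2) (ε / (2 * C + 1))) (by positivity)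
  obtain ⟨V, hV⟩ : ∃ V : E →L[R] E, V = 1 - (1 - p) ∘L (1 - P) := ⟨_, rfl⟩
  obtain ⟨W, hVW, hWV, hW⟩ := exists_inverse_of_norm_sub_le V (c := 1 / 2) (by norm_num)
    (by norm_num) (fun x => by
      have e : x - V x = (1 - P) x - p ((1 - P) x) := by
        simp only [hV, sub_apply, ContinuousLinearMap.comp_apply, one_apply_eq_self, map_sub]
        abel
      rw [e]
      exact (hpQ x).trans (mul_le_mul_of_nonneg_right (min_le_left _ _) (norm_nonneg _)))
  have hVP : ∀ x, V (P x) = P x := fun x => by simp [hV, hP]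
  have hWP : ∀ x, W (P x) = P x := fun x => by rw [← hVP x, hWV, hVP]
  -- `y - P (W y)` lies in the kernel of `P V⁻¹`, hence in the range of `p`
  have hpy : ∀ y, p (y - P (W y)) = y - P (W y) := fun y => by
    have e : y - P (W y) = p (W y - P (W y)) := by
      conv_lhs => rw [← hVW y, hWV]
      simp only [hV, sub_apply, ContinuousLinearMap.comp_apply, one_apply_eq_self, map_sub]
      abel
    rw [e, hp]
  have hidem : ∀ y, P (W (p (P (W y)))) = P (W (p y)) := fun y => by
    have h1 := congrArg (fun z => P (W z)) (hpy y)
    simp only [map_sub, hWP, hP, sub_self] at h1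
    exact (sub_eq_zero.1 h1).symm
  have hmem : ∀ x : P.range, (P ∘L W ∘L p ∘L P.range.subtypeL) x ∈ P.range := fun x => ⟨_, rfl⟩
  refine ⟨(P ∘L W ∘L p ∘L P.range.subtypeL).codRestrict _ hmem, fun x => Subtype.ext ?_, ?_, ?_⟩
  · change P (W (p (P (W (p x))))) = P (W (p x))
    rw [hidem, hp]
  · refine Submodule.fg_of_fg_map_injective P.range.subtype Subtype.val_injective ?_
    convert hpfg.map (P ∘L W).toLinearMap using 1
    refine le_antisymm ?_ ?_
    · rintro _ ⟨_, ⟨x, rfl⟩, rfl⟩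
      exact ⟨p x, ⟨x, rfl⟩, rfl⟩
    · rintro _ ⟨_, ⟨x, rfl⟩, rfl⟩
      exact ⟨_, ⟨⟨P (W x), ⟨_, rfl⟩⟩, rfl⟩, hidem x⟩
  · rintro ⟨v, hv⟩ hvs
    have hPv : P (W v) = v := by
      obtain ⟨x, rfl⟩ := hv
      exact (congrArg P (hWP x)).trans (hP x)
    have hn : ‖v - p v‖ ≤ ε / (2 * C + 1) :=
      (hps v ⟨_, hvs, rfl⟩).trans (min_le_right _ _)
    calc ‖v - P (W (p v))‖ = ‖P (W (v - p v))‖ := by rw [map_sub, map_sub, hPv]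
      _ ≤ C * ((1 - 1 / 2)⁻¹ * (ε / (2 * C + 1))) :=
          (hPC _).trans (mul_le_mul_of_nonneg_left
            ((hW _).trans (mul_le_mul_of_nonneg_left hn (by norm_num))) hC)
      _ = ε * (2 * C / (2 * C + 1)) := by ring
      _ ≤ ε * 1 := by
          gcongr
          rw [div_le_one (by positivity)]
          linarith
      _ = ε := mul_one _

end RangeApproximation

/-! ### Completeness and finite approximation of the standard module -/

section StandardModule

variable {A : Type*} [CStarAlgebra A]

theorem isBoundedSMul_of_cStarModule {E : Type*} [NormedAddCommGroup E] [NormedSpace ℂ E]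
    [Module Aᵐᵒᵖ E] [PartialOrder A] [CStarModule Aᵐᵒᵖ E] : IsBoundedSMul Aᵐᵒᵖ E :=
  .of_norm_smul_le norm_op_smul_le

namespace StandardModule

theorem norm_sq (x : StandardModule A) : ‖x‖ ^ 2 = ‖∑' i, star (x i) * x i‖ :=
  Real.sq_sqrt (norm_nonneg _)

theorem norm_le_of_norm_sum_le (x : StandardModule A) {c : ℝ} (hc : 0 ≤ c)
    (h : ∀ s : Finset ℕ, ‖∑ i ∈ s, star (x i) * x i‖ ≤ c ^ 2) : ‖x‖ ≤ c := by
  refine (sq_le_sq₀ (norm_nonneg _) hc).1 ?_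
  rw [norm_sq]
  exact le_of_tendsto (x.summable x).hasSum.norm (Filter.Eventually.of_forall h)

theorem sub_apply (x y : StandardModule A) (i : ℕ) : (x - y) i = x i - y i := rfl

/-- The linear map that replaces all but the first `n` coordinates by zero. -/
noncomputable def truncationₗ (A : Type*) [CStarAlgebra A] (n : ℕ) :
    StandardModule A →ₗ[Aᵐᵒᵖ] StandardModule A where
  toFun x := ⟨fun i => if i < n then x i else 0, by
    refine summable_of_ne_finset_zero (s := Finset.range n) fun i hi => ?_
    simp [Finset.mem_range.not.1 hi]⟩
  map_add' x y := Subtype.ext (funext fun i => by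
    change (if i < n then x i + y i else 0) = (if i < n then x i else 0) + if i < n then y i else 0
    split_ifs <;> simp)
  map_smul' a x := Subtype.ext (funext fun i => by
    change (if i < n then x i * a.unop else 0) = (if i < n then x i else 0) * a.unop
    split_ifs <;> simp)

theorem truncationₗ_apply (n : ℕ) (x : StandardModule A) (i : ℕ) :
    truncationₗ A n x i = if i < n then x i else 0 := rfl

variable [PartialOrder A] [StarOrderedRing A]

theorem norm_sum_le (x : StandardModule A) (s : Finset ℕ) :
    ‖∑ i ∈ s, star (x i) * x i‖ ≤ ‖x‖ ^ 2 := by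
  rw [norm_sq]
  exact CStarAlgebra.norm_le_norm_of_nonneg_of_le
    (Finset.sum_nonneg fun i _ => star_mul_self_nonneg _)
    ((x.summable x).sum_le_tsum s fun i _ => star_mul_self_nonneg _)

theorem norm_apply_le (x : StandardModule A) (i : ℕ) : ‖x i‖ ≤ ‖x‖ := by
  refine (sq_le_sq₀ (norm_nonneg _) (norm_nonneg _)).1 ?_
  have := x.norm_sum_le {i}
  rwa [Finset.sum_singleton, CStarRing.norm_star_mul_self, ← sq] at this

instance : CompleteSpace (StandardModule A) := by
  refine Metric.complete_of_cauchySeq_tendsto fun u hu => ?_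
  have hcoord : ∀ i, ∃ a, Filter.Tendsto (fun n => u n i) Filter.atTop (nhds a) := fun i => by
    refine cauchySeq_tendsto_of_complete (Metric.cauchySeq_iff.2 fun ε hε => ?_)
    obtain ⟨N, hN⟩ := Metric.cauchySeq_iff.1 hu ε hε
    refine ⟨N, fun m hm n hn => lt_of_le_of_lt ?_ (hN m hm n hn)⟩
    rw [dist_eq_norm, dist_eq_norm]
    exact (u m - u n).norm_apply_le i
  choose y hy using hcoord
  -- the partial sums of `∑ (uₙ - y)ᵢ⋆ (uₙ - y)ᵢ` are small, uniformly
  have hsum : ∀ ε > 0, ∃ N, ∀ n ≥ N, ∀ s : Finset ℕ,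
      ‖∑ i ∈ s, star (u n i - y i) * (u n i - y i)‖ ≤ ε ^ 2 := fun ε hε => by
    obtain ⟨N, hN⟩ := Metric.cauchySeq_iff.1 hu ε hε
    refine ⟨N, fun n hn s => ?_⟩
    have ht : Filter.Tendsto (fun m => ‖∑ i ∈ s, star (u n i - u m i) * (u n i - u m i)‖)
        Filter.atTop (nhds ‖∑ i ∈ s, star (u n i - y i) * (u n i - y i)‖) :=
      (tendsto_finsetSum _ fun i _ =>
        ((tendsto_const_nhds.sub (hy i)).star.mul (tendsto_const_nhds.sub (hy i)))).norm
    refine le_of_tendsto ht (Filter.eventually_atTop.2 ⟨N, fun m hm => ?_⟩)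
    refine ((u n - u m).norm_sum_le s).trans ?_
    gcongr
    rw [← dist_eq_norm]
    exact (hN n hn m hm).le
  have hmem : Summable fun i => star (y i) * y i := by
    rw [summable_iff_vanishing_norm]
    intro ε hε
    obtain ⟨N, hN⟩ := hsum √(ε / 5) (by positivity)
    obtain ⟨s, hs⟩ := summable_iff_vanishing_norm.1 ((u N).summable (u N)) (ε / 5) (by positivity)
    refine ⟨s, fun t ht => ?_⟩
    have h1 := hs t ht
    have h2 := hN N le_rfl t
    rw [Real.sq_sqrt (by positivity)] at h2
    -- termwise, `y⋆ y ≤ 2 u⋆ u + 2 (u - y)⋆ (u - y)`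
    have h3 : ‖∑ i ∈ t, star (y i) * y i‖
        ≤ ‖(∑ i ∈ t, star (u N i) * u N i + ∑ i ∈ t, star (u N i - y i) * (u N i - y i))
          + (∑ i ∈ t, star (u N i) * u N i + ∑ i ∈ t, star (u N i - y i) * (u N i - y i))‖ := by
      refine CStarAlgebra.norm_le_norm_of_nonneg_of_le
        (Finset.sum_nonneg fun i _ => star_mul_self_nonneg _) ?_
      rw [← Finset.sum_add_distrib, ← Finset.sum_add_distrib]
      refine Finset.sum_le_sum fun i _ => ?_
      have h : (0 : A) ≤ star (u N i + (u N i - y i)) * (u N i + (u N i - y i)) :=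
        star_mul_self_nonneg _
      rw [← sub_nonneg]
      convert h using 1
      simp only [star_add, star_sub]
      noncomm_ring
    have h4 := norm_add_le (∑ i ∈ t, star (u N i) * u N i)
      (∑ i ∈ t, star (u N i - y i) * (u N i - y i))
    have h5 := h3.trans (norm_add_le _ _)
    linarith
  let z : StandardModule A := ⟨y, hmem⟩
  refine ⟨z, Metric.tendsto_atTop.2 fun ε hε => ?_⟩
  obtain ⟨N, hN⟩ := hsum (ε / 2) (by positivity)
  refine ⟨N, fun n hn => ?_⟩
  rw [dist_eq_norm]
  exact ((u n - z).norm_le_of_norm_sum_le (by positivity) (hN n hn)).trans_lt (half_lt_self hε)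

theorem norm_truncationₗ_le (n : ℕ) (x : StandardModule A) : ‖truncationₗ A n x‖ ≤ ‖x‖ := by
  refine norm_le_of_norm_sum_le _ (norm_nonneg _) fun s => ?_
  have e : ∑ i ∈ s, star (truncationₗ A n x i) * truncationₗ A n x i
      = ∑ i ∈ s with i < n, star (x i) * x i := by
    rw [Finset.sum_filter]
    refine Finset.sum_congr rfl fun i _ => ?_
    rw [truncationₗ_apply]
    split_ifs <;> simp
  rw [e]
  exact x.norm_sum_le _

/-- The projection of `H_A` onto its first `n` coordinates. -/
noncomputable def truncation (A : Type*) [CStarAlgebra A] [PartialOrder A] [StarOrderedRing A]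
    (n : ℕ) : StandardModule A →L[Aᵐᵒᵖ] StandardModule A where
  toLinearMap := truncationₗ A n
  cont := AddMonoidHomClass.continuous_of_bound (truncationₗ A n) 1 fun x => by
    rw [one_mul]; exact norm_truncationₗ_le n x

theorem truncation_apply (n : ℕ) (x : StandardModule A) (i : ℕ) :
    truncation A n x i = if i < n then x i else 0 := rfl

theorem truncation_truncation (n : ℕ) (x : StandardModule A) :
    truncation A n (truncation A n x) = truncation A n x :=
  Subtype.ext (funext fun i => by simp only [truncation_apply]; split_ifs <;> rfl)

/-- The standard basis vectors of `H_A`. -/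
noncomputable def basisVector (A : Type*) [CStarAlgebra A] (j : ℕ) : StandardModule A :=
  ⟨fun i => if i = j then 1 else 0, summable_of_ne_finset_zero (s := {j}) fun i hi => by
    simp [Finset.mem_singleton.not.1 hi]⟩

theorem truncation_eq_sum (n : ℕ) (x : StandardModule A) :
    truncation A n x = ∑ j ∈ Finset.range n, MulOpposite.op (x j) • basisVector A j := by
  refine Subtype.ext (funext fun i => ?_)
  have e : ((∑ j ∈ Finset.range n, MulOpposite.op (x j) • basisVector A j : StandardModule A) :
      ℕ → A) i = ∑ j ∈ Finset.range n, (if i = j then 1 else 0) * x j := by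
    refine (congrFun (map_sum (standardSubmodule A).subtype _ _) i).trans ?_
    rw [Finset.sum_apply]
    rfl
  rw [truncation_apply, e]
  simp

theorem fg_range_truncation (n : ℕ) : (truncation A n).range.FG := by
  have e : (truncation A n).range = (Submodule.span Aᵐᵒᵖ
      (basisVector A '' Finset.range n)).map (truncation A n).toLinearMap := by
    refine le_antisymm ?_ (LinearMap.map_le_range)
    rintro _ ⟨x, rfl⟩
    refine ⟨truncation A n x, ?_, truncation_truncation n x⟩
    rw [truncation_eq_sum]
    exact Submodule.sum_smul_mem _ _ fun j hj => Submodule.subset_span ⟨j, hj, rfl⟩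
  rw [e]
  exact (Submodule.fg_span ((Finset.finite_toSet _).image _)).map _

theorem eventually_norm_sub_truncation_le (x : StandardModule A) {ε : ℝ} (hε : 0 < ε) :
    ∀ᶠ n in Filter.atTop, ‖x - truncation A n x‖ ≤ ε := by
  obtain ⟨S, hS⟩ := summable_iff_vanishing_norm.1 (x.summable x) (ε ^ 2) (by positivity)
  obtain ⟨m, hm⟩ := S.exists_nat_subset_range
  filter_upwards [Filter.eventually_ge_atTop m] with n hn
  refine norm_le_of_norm_sum_le _ hε.le fun s => ?_
  have e : ∑ i ∈ s, star ((x - truncation A n x) i) * (x - truncation A n x) i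
      = ∑ i ∈ s with ¬ i < n, star (x i) * x i := by
    rw [Finset.sum_filter]
    refine Finset.sum_congr rfl fun i _ => ?_
    rw [sub_apply, truncation_apply]
    split_ifs <;> simp
  rw [e]
  have hdisj : Disjoint (s.filter fun i => ¬ i < n) S := Finset.disjoint_left.2 fun i hi hi' =>
    (Finset.mem_filter.1 hi).2 ((Finset.mem_range.1 (hm hi')).trans_le hn)
  exact (hS _ hdisj).le

theorem hasFiniteApproximation : HasFiniteApproximation Aᵐᵒᵖ (StandardModule A) := by
  intro s ε hs hε
  obtain ⟨n, hn⟩ := ((Filter.eventually_all_finite hs).2 fun v _ =>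
    v.eventually_norm_sub_truncation_le hε).exists
  exact ⟨truncation A n, truncation_truncation n, fg_range_truncation n, hn⟩

end StandardModule

end StandardModule

/-! ### Adjointability of compressions -/

section Adjoints

variable {A : Type*} [CStarAlgebra A] [PartialOrder A]
variable {E : Type*} [NormedAddCommGroup E] [NormedSpace ℂ E] [Module Aᵐᵒᵖ E] [CStarModule Aᵐᵒᵖ E]

theorem isAdjointable_centralOp (α : Subalgebra.center ℂ A) : IsAdjointable (centralOp E α) := by
  have hα : ∀ b : A, star (α : A) * b = b * star (α : A) := fun b => by
    simpa using (congrArg star (Subalgebra.mem_center_iff.1 α.2 (star b)))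
  refine ⟨centralOp E ⟨star (α : A), Subalgebra.mem_center_iff.2 fun b => (hα b).symm⟩,
    fun x y => ?_⟩
  change inner Aᵐᵒᵖ (MulOpposite.op (α : A) • x) y
    = inner Aᵐᵒᵖ x (MulOpposite.op (star (α : A)) • y)
  rw [CStarModule.inner_op_smul_left, CStarModule.inner_op_smul_right]
  exact MulOpposite.unop_injective (hα _)

theorem IsAdjointable.sub {F G : E →L[Aᵐᵒᵖ] E} (hF : IsAdjointable F) (hG : IsAdjointable G) :
    IsAdjointable (F - G) := by
  obtain ⟨F', hF⟩ := hF
  obtain ⟨G', hG⟩ := hG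
  exact ⟨F' - G', fun x y => by simp [hF, hG]⟩

theorem eq_of_inner_eq {y z : E} (h : ∀ x : E, inner Aᵐᵒᵖ x y = inner Aᵐᵒᵖ x z) : y = z := by
  rw [← sub_eq_zero, ← CStarModule.inner_self (A := Aᵐᵒᵖ), CStarModule.inner_sub_right,
    h, sub_self]

variable [StarOrderedRing A]

/-- The mixed terms in `⟪x + V x, x + V x⟫` cancel. -/
theorem norm_le_norm_add_of_skew {V : E →L[ℂ] E}
    (hV : ∀ x y : E, inner Aᵐᵒᵖ (V x) y = -inner Aᵐᵒᵖ x (V y)) (x : E) : ‖x‖ ≤ ‖x + V x‖ := by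
  refine (sq_le_sq₀ (norm_nonneg _) (norm_nonneg _)).1 ?_
  rw [CStarModule.norm_sq_eq Aᵐᵒᵖ, CStarModule.norm_sq_eq Aᵐᵒᵖ]
  refine CStarAlgebra.norm_le_norm_of_nonneg_of_le CStarModule.inner_self_nonneg ?_
  have e : inner Aᵐᵒᵖ (x + V x) (x + V x) = inner Aᵐᵒᵖ x x + inner Aᵐᵒᵖ (V x) (V x) := by
    have := hV x x
    simp only [CStarModule.inner_add_left, CStarModule.inner_add_right, this]
    abel
  rw [e]
  exact le_add_of_nonneg_right CStarModule.inner_self_nonneg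

/-- For skew-adjoint `V` the operator `1 + V` is invertible. The operators `1 + t V` are
bounded below by `1`, so that invertibility propagates from `t = 0` to `t = 1` in steps of fixed
length. -/
theorem isUnit_one_add_of_skew [CompleteSpace E] {V : E →L[ℂ] E}
    (hV : ∀ x y : E, inner Aᵐᵒᵖ (V x) y = -inner Aᵐᵒᵖ x (V y)) : IsUnit (1 + V) := by
  obtain ⟨N, hN⟩ := exists_nat_gt ‖V‖
  have hN0 : (0 : ℝ) < N := (norm_nonneg _).trans_lt hN
  obtain ⟨U, hU⟩ : ∃ U : E →L[ℂ] E, U = (N : ℂ)⁻¹ • V := ⟨_, rfl⟩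
  have hU1 : ‖U‖ < 1 := by
    rw [hU, norm_smul, norm_inv, Complex.norm_natCast, inv_mul_lt_iff₀ hN0, mul_one]
    exact hN
  have hskew : ∀ (n : ℕ) (x y : E),
      inner Aᵐᵒᵖ (((n : ℂ) • U) x) y = -inner Aᵐᵒᵖ x (((n : ℂ) • U) y) := fun n x y => by
    simp [hU, hV]
  have key : ∀ n : ℕ, IsUnit (1 + (n : ℂ) • U) := fun n => by
    induction n with
    | zero => simp
    | succ n ih =>
      obtain ⟨u, hu⟩ := ih
      have hinv : ‖(↑u⁻¹ : E →L[ℂ] E)‖ ≤ 1 := by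
        refine ContinuousLinearMap.opNorm_le_bound _ zero_le_one fun x => ?_
        have h1 := norm_le_norm_add_of_skew (hskew n) ((↑u⁻¹ : E →L[ℂ] E) x)
        have h2 : (u : E →L[ℂ] E) ((↑u⁻¹ : E →L[ℂ] E) x) = x := DFunLike.congr_fun u.mul_inv x
        rw [hu] at h2
        rw [one_mul]
        exact h1.trans_eq (congrArg norm h2)
      have hsmall : ‖-((↑u⁻¹ : E →L[ℂ] E) * U)‖ < 1 := by
        rw [norm_neg]
        refine (norm_mul_le _ _).trans_lt ?_
        nlinarith [norm_nonneg U]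
      have e : 1 + ((n + 1 : ℕ) : ℂ) • U = u * (1 - -((↑u⁻¹ : E →L[ℂ] E) * U)) := by
        rw [sub_neg_eq_add, mul_add, mul_one, Units.mul_inv_cancel_left, hu]
        push_cast
        rw [add_smul, one_smul, add_assoc]
      rw [e]
      exact u.isUnit.mul (isUnit_one_sub_of_norm_lt_one hsmall)
  have h := key N
  rwa [hU, smul_smul, mul_inv_cancel₀ (by exact_mod_cast hN0.ne'), one_smul] at h

variable [IsScalarTower ℂ Aᵐᵒᵖ E]

/-- With `V = P - P⋆` the operator `1 - V² = (1 - V) (1 + V)` has an inverse `J`, and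
`P⋆ (1 - V²) = P⋆ P P⋆`. Hence `P P⋆ J w` is the element of `R(P)` that has the same inner
products with `R(P)` as `w`. -/
theorem isAdjointable_compression [CompleteSpace E] {F P : E →L[Aᵐᵒᵖ] E}
    (hF : IsAdjointable F) (hP : IsAdjointable P) (hproj : ∀ x, P (P x) = P x) :
    IsAdjointable (compression P F) := by
  obtain ⟨F', hF⟩ := hF
  obtain ⟨P', hP⟩ := hP
  have hP2 : ∀ x y : E, inner Aᵐᵒᵖ (P' x) y = inner Aᵐᵒᵖ x (P y) := fun x y => by
    rw [← CStarModule.star_inner, ← hP, CStarModule.star_inner]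
  have hproj' : ∀ y, P' (P' y) = P' y := fun y => eq_of_inner_eq (A := A) fun x => by
    rw [← hP, ← hP, hproj, hP]
  have hV : ∀ x y : E, inner Aᵐᵒᵖ ((P - P') x) y = -inner Aᵐᵒᵖ x ((P - P') y) := fun x y => by
    simp [hP, hP2]
  have hV' : ∀ x y : E, inner Aᵐᵒᵖ ((P' - P) x) y = -inner Aᵐᵒᵖ x ((P' - P) y) := fun x y => by
    simp [hP, hP2]
  obtain ⟨J₁, hJ₁, -⟩ := exists_inverse_of_isUnit (1 + (P - P'))
    (isUnit_one_add_of_skew (V := (P - P').restrictScalars ℂ) hV)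
  obtain ⟨J₂, hJ₂, -⟩ := exists_inverse_of_isUnit (1 + (P' - P))
    (isUnit_one_add_of_skew (V := (P' - P).restrictScalars ℂ) hV')
  have hJ : ∀ w, P' (P (P' (J₁ (J₂ w)))) = P' w := fun w => by
    conv_rhs => rw [← hJ₂ w, ← hJ₁ (J₂ w)]
    simp only [add_apply, sub_apply, one_apply_eq_self, map_add, map_sub, hproj, hproj']
    abel
  refine ⟨(P ∘L P' ∘L J₁ ∘L J₂ ∘L F' ∘L P' ∘L P.range.subtypeL).codRestrict P.range
    fun _ => ⟨_, rfl⟩, ?_⟩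
  rintro ⟨x, hx⟩ ⟨y, hy⟩
  change inner Aᵐᵒᵖ (P (F x)) y = inner Aᵐᵒᵖ x (P (P' (J₁ (J₂ (F' (P' y))))))
  have hPx : P x = x := by
    obtain ⟨z, rfl⟩ := hx
    exact hproj z
  rw [hP, hF]
  conv_lhs => rw [← hPx, hP, ← hJ, ← hP, hPx]

end Adjoints

/-! ### Fredholm decompositions of compressions -/

section Compression

variable {A : Type*} [CStarAlgebra A]
variable {E : Type*} [NormedAddCommGroup E] [NormedSpace ℂ E] [Module Aᵐᵒᵖ E]

theorem compression_sub_centralOp [PartialOrder A] [CStarModule Aᵐᵒᵖ E]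
    [IsScalarTower ℂ Aᵐᵒᵖ E] {F P : E →L[Aᵐᵒᵖ] E} (hproj : ∀ x, P (P x) = P x)
    (α : Subalgebra.center ℂ A) :
    compression P (F - centralOp E α) = compression P F - centralOp P.range α := by
  ext ⟨x, hx⟩
  have hPx : P x = x := by
    obtain ⟨z, rfl⟩ := hx
    exact hproj z
  change P (F x - MulOpposite.op (α : A) • x) = P (F x) - MulOpposite.op (α : A) • x
  rw [map_sub, map_smul, hPx]

variable [IsScalarTower ℂ Aᵐᵒᵖ E] [IsBoundedSMul Aᵐᵒᵖ E] [CompleteSpace E]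

/-- A parametrix `S` of `T` compresses to the parametrix `P S|_{R(P)}` of the compression of `T`,
and a parametrix `S` of the compression extends to the parametrix `S P` of `T`. In both
directions the new defects differ from the old ones by terms containing the factor `1 - P`. -/
theorem hasFredholmDecomposition_compression_iff
    (hE : HasFiniteApproximation Aᵐᵒᵖ E) {T P : E →L[Aᵐᵒᵖ] E} (hproj : ∀ x, P (P x) = P x)
    (hker : P.ker.FG) :
    HasFredholmDecomposition T ↔ HasFredholmDecomposition (compression P T) := by
  have hQ : IsFiniteType (1 - P) :=
    isFiniteType_of_mem _ P.isClosed_ker hker fun x => by simp [hproj]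
  have hclosed : IsClosed (P.range : Set E) :=
    (ContinuousLinearMap.IsIdempotentElem.isTopCompl
      (show IsIdempotentElem P from ContinuousLinearMap.ext hproj)).isClosed
  have : CompleteSpace P.range := hclosed.completeSpace_coe
  have : IsBoundedSMul Aᵐᵒᵖ P.range := .of_norm_smul_le fun a x => norm_smul_le a (x : E)
  obtain ⟨π, hπ⟩ : ∃ π : E →L[Aᵐᵒᵖ] P.range, ∀ x, (π x : E) = P x :=
    ⟨P.codRestrict P.range fun _ => ⟨_, rfl⟩, fun _ => rfl⟩
  have hfix : ∀ x : P.range, P x = x := by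
    rintro ⟨_, z, rfl⟩
    exact hproj z
  have hcomp : ∀ x : P.range, compression P T x = π (T x) := fun x => Subtype.ext (hπ _).symm
  constructor
  · intro h
    obtain ⟨S, hl, hr⟩ := h.exists_parametrix
    refine hasFredholmDecomposition_of_parametrix (hE.range hproj hQ)
      (S := π ∘L S ∘L P.range.subtypeL) ?_ ?_
    · convert ((hl.comp_left π).comp_right P.range.subtypeL).add
        ((hQ.comp_left (π ∘L S)).comp_right (T ∘L P.range.subtypeL)) using 1
      ext x
      simp [hcomp, hπ, hfix]
    · convert ((hr.comp_left π).comp_right P.range.subtypeL).add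
        ((hQ.comp_left (π ∘L T)).comp_right (S ∘L P.range.subtypeL)) using 1
      ext x
      simp [hcomp, hπ, hfix]
  · intro h
    obtain ⟨S, hl, hr⟩ := h.exists_parametrix
    refine hasFredholmDecomposition_of_parametrix hE (S := P.range.subtypeL ∘L S ∘L π) ?_ ?_
    · convert (((hl.comp_left P.range.subtypeL).comp_right π).add hQ).add
        ((hQ.comp_left (-(P.range.subtypeL ∘L S ∘L π ∘L T)))) using 1
      ext x
      simp only [hcomp, hπ, sub_apply, add_apply, neg_apply, one_apply_eq_self, map_sub,
        ContinuousLinearMap.comp_apply, Submodule.subtypeL_apply]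
      abel
    · convert (((hr.comp_left P.range.subtypeL).comp_right π).add hQ).add
        ((hQ.comp_right (-(T ∘L P.range.subtypeL ∘L S ∘L π)))) using 1
      ext x
      simp [hcomp, hπ]

end Compression

end HilbertModule

theorem corollary3p2 {A : Type*} [CStarAlgebra A] [PartialOrder A] [StarOrderedRing A]
    (F P : HilbertModule.StandardModule A →L[Aᵐᵒᵖ] HilbertModule.StandardModule A)
    (hF : HilbertModule.IsAdjointable F) (hP : HilbertModule.IsAdjointable P)
    (hproj : P ∘L P = P) (hker : P.ker.FG) :
    HilbertModule.essentialSpectrum F =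
      HilbertModule.essentialSpectrum (HilbertModule.compression P F) := by
  have hproj' : ∀ x, P (P x) = P x := DFunLike.congr_fun hproj
  have : IsBoundedSMul Aᵐᵒᵖ (HilbertModule.StandardModule A) :=
    HilbertModule.isBoundedSMul_of_cStarModule
  ext α
  refine not_congr ?_
  have hFα := hF.sub (HilbertModule.isAdjointable_centralOp α)
  have hcomp := HilbertModule.isAdjointable_compression hFα hP hproj'
  have key := HilbertModule.hasFredholmDecomposition_compression_iff
    HilbertModule.StandardModule.hasFiniteApproximation (T := F - HilbertModule.centralOp _ α)
    hproj' hker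
  rw [HilbertModule.compression_sub_centralOp hproj'] at key hcomp
  exact ⟨fun h => ⟨hcomp, key.1 h.2⟩, fun h => ⟨hFα, key.2 h.2⟩⟩
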